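/- Let $\mathbb{B}$ be the open unit ball of the quaternions $\mathbb{H}$, let $\mathrm{Sp}(1)=\{u\in\mathbb{H}:|u|=1\}$ and let $\mathrm{Sp}(1,1)=\{A\in M_2(\mathbb{H}) : A^*I_{1,1}A=I_{1,1}\}$, where $I_{1,1}=\mathrm{diag}(1,-1)$, with its structure of embedded submanifold of $M_2(\mathbb{H})$. For functions on $\mathbb{B}$ with expansions $f(q)=\sum_n q^na_n$, $g(q)=\sum_n q^nb_n$ (slice regular functions) put $(f*g)(q)=\sum_n q^n\sum_{k=0}^n a_kb_{n-k}$, $f^c(q)=\sum_n q^n\overline{a_n}$, $f^s=f*f^c$ and $f^{-*}=(f^s)^{-1}f^c$ (where $f^s\neq 0$). For $A=\begin{pmatrix}a&c\\b&d\end{pmatrix}\in\mathrm{Sp}(1,1)$ the regular M\"obius transformation $\mathcal{F}_A:\mathbb{B}\to\mathbb{B}$ is $\mathcal{F}_A=(qc+d)^{-*}*(qa+b)$. Let $\mathcal{M}(\mathbb{B})=\{\mathcal{F}_A : A\in\mathrm{Sp}(1,1)\}$ and $\mathcal{M}(\mathbb{B})_0=\{\mathcal{F}\in\mathcal{M}(\mathbb{B}):\mathcal{F}(0)=0\}$.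 Then $\mathcal{M}(\mathbb{B})$ has a smooth ($7$-dimensional) manifold structure for which the map $\mathrm{Sp}(1,1)\to\mathcal{M}(\mathbb{B})$, $A\mapsto\mathcal{F}_{A^{-1}}$, is a submersion, i.e. a surjective smooth map whose differential is surjective at every point (this property determines the structure); and $\mathcal{M}(\mathbb{B})_0$ is an embedded submanifold of $\mathcal{M}(\mathbb{B})$ which, with the composition of maps, is a Lie group. For these structures the map $$\mathcal{M}(\mathbb{B})_0\times\mathcal{M}(\mathbb{B})\to\mathcal{M}(\mathbb{B}),\qquad(\mathcal{F}_0,\mathcal{F})\mapsto\mathcal{F}_0\circ\mathcal{F},$$ is well defined and is a smooth action of the Lie group $\mathcal{M}(\mathbb{B})_0$ on the manifold $\mathcal{M}(\mathbb{B})$. This action is free (if $\mathcal{F}_0\circ\mathcal{F}=\mathcal{F}$ for some $\mathcal{F}$, then $\mathcal{F}_0$ is the identity) and proper (for every compact $K\subset\mathcal{M}(\mathbb{B})$ the set $\{\mathcal{F}_0\in\mathcal{M}(\mathbb{B})_0 : \mathcal{F}_0K\cap K\neq\emptyset\}$ is compact). -/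

import Mathlib

open scoped Quaternion Manifold ContDiff Matrix

noncomputable section

namespace SliceMobius

/-- `ℍ` has real dimension `3 + 1`, so that Mathlib makes its unit sphere a smooth `3`-manifold. -/
instance finrank_quaternion_fact : Fact (Module.finrank ℝ ℍ[ℝ] = 3 + 1) :=
  ⟨Quaternion.finrank_eq_four⟩

/-- The open unit ball `𝔹` of the quaternions (an open submanifold of `ℍ`). -/
def Ball : TopologicalSpace.Opens ℍ[ℝ] := ⟨Metric.ball 0 1, Metric.isOpen_ball⟩

/-- `Sp(1)`, the unit quaternions; group and smooth structures on the sphere are Mathlib's. -/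
abbrev Sp1 : Type := Metric.sphere (0 : ℍ[ℝ]) 1

/-- `2 × 2` matrices with quaternionic entries. -/
abbrev Mat2 : Type := Matrix (Fin 2) (Fin 2) ℍ[ℝ]

/-- The matrix `I_{1,1} = diag(1, -1)`. -/
def I11 : Mat2 := !![1, 0; 0, -1]

theorem I11_mul_I11 : I11 * I11 = 1 := by
  refine Matrix.ext fun i j => ?_; fin_cases i <;> fin_cases j <;> simp [I11, Matrix.mul_apply]

theorem I11_conjTranspose : I11ᴴ = I11 := by
  refine Matrix.ext fun i j => ?_; fin_cases i <;> fin_cases j <;> simp [I11]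

/-- `Sp(1,1) = {A ∈ M₂(ℍ) : A* I_{1,1} A = I_{1,1}}`. It carries the subspace topology. -/
def Sp11 : Submonoid Mat2 where
  carrier := {A | Aᴴ * I11 * A = I11}
  mul_mem' := by
    intro A B hA hB
    change Aᴴ * I11 * A = I11 at hA
    change Bᴴ * I11 * B = I11 at hB
    change (A * B)ᴴ * I11 * (A * B) = I11
    calc (A * B)ᴴ * I11 * (A * B) = Bᴴ * (Aᴴ * I11 * A) * B := by
          rw [Matrix.conjTranspose_mul]; simp only [Matrix.mul_assoc]
      _ = I11 := by rw [hA, hB]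
  one_mem' := by simp

theorem Sp11.inv_mul (A : Sp11) : (I11 * (A : Mat2)ᴴ * I11) * A = 1 := by
  have h : (A : Mat2)ᴴ * I11 * A = I11 := A.2
  calc (I11 * (A : Mat2)ᴴ * I11) * A = I11 * ((A : Mat2)ᴴ * I11 * A) := by
        simp only [Matrix.mul_assoc]
    _ = 1 := by rw [h, I11_mul_I11]

theorem Sp11.mul_inv (A : Sp11) : (A : Mat2) * (I11 * (A : Mat2)ᴴ * I11) = 1 :=
  mul_eq_one_comm.mp (Sp11.inv_mul A)

/-- `Sp(1,1)` is a group under matrix multiplication, with `A⁻¹ = I_{1,1} A* I_{1,1}`. -/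
instance : Group Sp11 where
  inv A := ⟨I11 * (A : Mat2)ᴴ * I11, by
    change (I11 * (A : Mat2)ᴴ * I11)ᴴ * I11 * (I11 * (A : Mat2)ᴴ * I11) = I11
    simp only [Matrix.conjTranspose_mul, Matrix.conjTranspose_conjTranspose, I11_conjTranspose]
    calc I11 * ((A : Mat2) * I11) * I11 * (I11 * (A : Mat2)ᴴ * I11)
        = I11 * (A : Mat2) * (I11 * I11) * (I11 * (A : Mat2)ᴴ * I11) := by
          simp only [Matrix.mul_assoc]
      _ = I11 * ((A : Mat2) * (I11 * (A : Mat2)ᴴ * I11)) := by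
          rw [I11_mul_I11]; simp only [Matrix.mul_assoc, Matrix.one_mul]
      _ = I11 := by rw [Sp11.mul_inv A, Matrix.mul_one]⟩
  inv_mul_cancel A := Subtype.ext (Sp11.inv_mul A)

theorem Sp11.inv_apply (A : Sp11) : A⁻¹.1 0 0 = star (A.1 0 0) ∧ A⁻¹.1 0 1 = -star (A.1 1 0) ∧
    A⁻¹.1 1 0 = -star (A.1 0 1) ∧ A⁻¹.1 1 1 = star (A.1 1 1) := by
  have h : ∀ i j, A⁻¹.1 i j = (I11 * (A : Mat2)ᴴ * I11) i j := fun _ _ => rfl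
  have e00 : I11 0 0 = 1 := rfl
  have e01 : I11 0 1 = 0 := rfl
  have e10 : I11 1 0 = 0 := rfl
  have e11 : I11 1 1 = -1 := rfl
  refine ⟨?_, ?_, ?_, ?_⟩ <;> rw [h] <;>
    simp only [Matrix.mul_apply, Fin.sum_univ_two, Matrix.conjTranspose_apply, e00, e01, e10, e11] <;>
    simp

theorem Sp11.col_rel (A : Sp11) : 
    star (A.1 0 0) * A.1 0 0 - star (A.1 1 0) * A.1 1 0 = 1 ∧
    star (A.1 0 0) * A.1 0 1 = star (A.1 1 0) * A.1 1 1 ∧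
    star (A.1 1 1) * A.1 1 1 - star (A.1 0 1) * A.1 0 1 = 1 := by
  have h : (A : Mat2)ᴴ * I11 * A = I11 := A.2
  have h00 := congrFun (congrFun h 0) 0
  have h01 := congrFun (congrFun h 0) 1
  have h11 := congrFun (congrFun h 1) 1
  simp [Matrix.mul_apply, I11] at h00 h01 h11
  refine ⟨by rw [← h00]; abel, ?_, ?_⟩
  · rw [← sub_eq_zero, ← h01]; abel
  · rw [← neg_inj, ← h11]; abel

theorem Sp11.row_rel (A : Sp11) : 
    A.1 0 0 * star (A.1 0 0) - A.1 0 1 * star (A.1 0 1) = 1 ∧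
    A.1 0 0 * star (A.1 1 0) = A.1 0 1 * star (A.1 1 1) ∧
    A.1 1 1 * star (A.1 1 1) - A.1 1 0 * star (A.1 1 0) = 1 := by
  have h : (A : Mat2) * I11 * (A : Mat2)ᴴ = I11 := by
    have h' := congrArg (· * I11) (Sp11.mul_inv A)
    simpa [Matrix.mul_assoc, I11_mul_I11] using h'
  have h00 := congrFun (congrFun h 0) 0
  have h01 := congrFun (congrFun h 0) 1
  have h11 := congrFun (congrFun h 1) 1
  simp [Matrix.mul_apply, I11] at h00 h01 h11
  refine ⟨by rw [← h00]; abel, ?_, ?_⟩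
  · rw [← sub_eq_zero, ← h01]; abel
  · rw [← neg_inj, ← h11]; abel

theorem Sp11.norm_rel (A : Sp11) : ‖A.1 0 0‖ ^ 2 - ‖A.1 1 0‖ ^ 2 = 1 ∧
    ‖A.1 1 1‖ ^ 2 - ‖A.1 0 1‖ ^ 2 = 1 ∧ ‖A.1 0 0‖ ^ 2 - ‖A.1 0 1‖ ^ 2 = 1 ∧
    ‖A.1 1 1‖ ^ 2 - ‖A.1 1 0‖ ^ 2 = 1 := by
  obtain ⟨h1, -, h2⟩ := Sp11.col_rel A
  obtain ⟨h3, -, h4⟩ := Sp11.row_rel A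
  simp only [Quaternion.star_mul_self, Quaternion.self_mul_star, Quaternion.normSq_eq_norm_mul_self] at h1 h2 h3 h4
  have h1 := congrArg QuaternionAlgebra.re h1
  have h2 := congrArg QuaternionAlgebra.re h2
  have h3 := congrArg QuaternionAlgebra.re h3
  have h4 := congrArg QuaternionAlgebra.re h4
  simp at h1 h2 h3 h4
  refine ⟨?_, ?_, ?_, ?_⟩ <;> linarith

/-! ### Slice regular functions on the ball and their operations -/

/-- `f(q) = ∑ qⁿ aₙ` on `𝔹`. The functions that have such an expansion (with coefficients on the
right) are exactly the slice regular functions on `𝔹`. -/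
def HasSliceExpansion (f : Ball → ℍ[ℝ]) (a : ℕ → ℍ[ℝ]) : Prop :=
  ∀ q : Ball, HasSum (fun n => (q : ℍ[ℝ]) ^ n * a n) (f q)

open Classical in
/-- The coefficients of the power series of a slice regular function (they are unique, see
`HasSliceExpansion.unique`); the value `0` is a placeholder for the other functions. -/
def coeffs (f : Ball → ℍ[ℝ]) : ℕ → ℍ[ℝ] :=
  if h : ∃ a, HasSliceExpansion f a then h.choose else 0

/-- The regular product `f * g = ∑ qⁿ cₙ`, `cₙ = ∑_{k ≤ n} a_k b_{n-k}`. -/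
def starMul (f g : Ball → ℍ[ℝ]) : Ball → ℍ[ℝ] := fun q =>
  ∑' n, (q : ℍ[ℝ]) ^ n * ∑ k ∈ Finset.range (n + 1), coeffs f k * coeffs g (n - k)

/-- The regular conjugate `fᶜ = ∑ qⁿ (conjugate of aₙ)`. -/
def regConj (f : Ball → ℍ[ℝ]) : Ball → ℍ[ℝ] := fun q =>
  ∑' n, (q : ℍ[ℝ]) ^ n * star (coeffs f n)

/-- The symmetrization `fˢ = f * fᶜ`. -/
def symmetrization (f : Ball → ℍ[ℝ]) : Ball → ℍ[ℝ] := starMul f (regConj f)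

/-- The regular reciprocal `f^{-*} = (1 / fˢ) fᶜ`. -/
def starInv (f : Ball → ℍ[ℝ]) : Ball → ℍ[ℝ] := fun q =>
  (symmetrization f q)⁻¹ * regConj f q

/-- `l_{(a,b)}(q) = q a + b`. -/
def linFun (a b : ℍ[ℝ]) : Ball → ℍ[ℝ] := fun q => (q : ℍ[ℝ]) * a + b

/-- The regular Möbius transformation `𝓕_A = l_{(c,d)}^{-*} * l_{(a,b)}` for the matrix `A` with
rows `(a, c)` and `(b, d)`, as a function with values in `ℍ`. -/
def mobiusFun (A : Sp11) : Ball → ℍ[ℝ] :=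
  starMul (starInv (linFun (A.1 0 1) (A.1 1 1))) (linFun (A.1 0 0) (A.1 1 0))

/-! ### `𝓕_A` maps the ball to itself -/

theorem Ball.mem_iff {x : ℍ[ℝ]} : x ∈ Ball ↔ ‖x‖ < 1 := by
  change x ∈ Metric.ball (0 : ℍ[ℝ]) 1 ↔ _
  simp

theorem Ball.norm_lt (q : Ball) : ‖(q : ℍ[ℝ])‖ < 1 := by
  exact Ball.mem_iff.1 q.2

theorem HasSliceExpansion.unique {f : Ball → ℍ[ℝ]} {a b : ℕ → ℍ[ℝ]}
    (ha : HasSliceExpansion f a) (hb : HasSliceExpansion f b) : a = b := by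
  have key : ∀ c : ℕ → ℍ[ℝ], HasSliceExpansion f c → 
      HasFPowerSeriesAt (fun t : ℝ => if h : |t| < 1 then f ⟨(t : ℍ[ℝ]), Ball.mem_iff.2 (by simpa using h)⟩ else 0)
        (show FormalMultilinearSeries ℝ ℝ ℍ[ℝ] from
          fun n => ContinuousMultilinearMap.mkPiRing ℝ (Fin n) (c n)) 0 := by
    intro c hc
    refine hasFPowerSeriesAt_iff.2 ?_
    filter_upwards [Metric.ball_mem_nhds (0 : ℝ) one_pos] with t ht
    have ht' : |t| < 1 := by simpa using ht
    rw [zero_add, dif_pos ht']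
    have e : (fun n => t ^ n • FormalMultilinearSeries.coeff (show FormalMultilinearSeries ℝ ℝ ℍ[ℝ] from
          fun n => ContinuousMultilinearMap.mkPiRing ℝ (Fin n) (c n)) n) =
        fun n => (t : ℍ[ℝ]) ^ n * c n := by
      funext n
      have : FormalMultilinearSeries.coeff (show FormalMultilinearSeries ℝ ℝ ℍ[ℝ] from
          fun n => ContinuousMultilinearMap.mkPiRing ℝ (Fin n) (c n)) n = c n := by
        simp [FormalMultilinearSeries.coeff]
      rw [this, ← Quaternion.coe_pow, Quaternion.coe_mul_eq_smul]
    rw [e]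
    exact hc ⟨(t : ℍ[ℝ]), Ball.mem_iff.2 (by simpa using ht')⟩
  have h := (key a ha).eq_formalMultilinearSeries (key b hb)
  funext n
  have := congrArg (fun p => FormalMultilinearSeries.coeff p n) h
  simpa [FormalMultilinearSeries.coeff] using this

theorem HasSliceExpansion.coeffs_eq {f : Ball → ℍ[ℝ]} {a : ℕ → ℍ[ℝ]}
    (ha : HasSliceExpansion f a) : coeffs f = a := by
  have h : ∃ a, HasSliceExpansion f a := ⟨a, ha⟩
  rw [coeffs, dif_pos h]
  exact h.choose_spec.unique ha

theorem linFun_expansion (a b : ℍ[ℝ]) :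
    HasSliceExpansion (linFun a b) (fun n => if n = 0 then b else if n = 1 then a else 0) := by
  intro q
  have : HasSum (fun n => (q : ℍ[ℝ]) ^ n * (if n = 0 then b else if n = 1 then a else 0))
      (∑ n ∈ Finset.range 2, (q : ℍ[ℝ]) ^ n * (if n = 0 then b else if n = 1 then a else 0)) :=
    hasSum_sum_of_ne_finset_zero (by
    intro n hn
    have : n ≠ 0 ∧ n ≠ 1 := by simp at hn; omega
    simp [this])
  convert this using 1
  simp [Finset.sum_range_succ, linFun, add_comm]


theorem linFun_regConj (a b : ℍ[ℝ]) : regConj (linFun a b) = linFun (star a) (star b) := by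
  funext q
  rw [regConj, (linFun_expansion a b).coeffs_eq, ← (linFun_expansion (star a) (star b) q).tsum_eq]
  refine tsum_congr fun n => ?_
  dsimp only
  split_ifs <;> simp

theorem starMul_linFun {f : Ball → ℍ[ℝ]} {h : ℕ → ℍ[ℝ]} (hf : HasSliceExpansion f h)
    (a b : ℍ[ℝ]) (q : Ball) : starMul f (linFun a b) q = f q * b + q * f q * a := by
  have hconv : ∀ n, ∑ k ∈ Finset.range (n + 2), h k *
      (fun n => if n = 0 then b else if n = 1 then a else 0) (n + 1 - k) = h (n + 1) * b + h n * a := by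
    intro n
    rw [Finset.sum_range_succ, Finset.sum_range_succ, Finset.sum_eq_zero]
    · simp [add_comm]
    · intro k hk
      have hk := Finset.mem_range.1 hk
      have h0 : n + 1 - k ≠ 0 := by omega
      have h1 : n + 1 - k ≠ 1 := by omega
      simp [h0, h1]
  have hs := (hf q).summable
  have hs1 : Summable fun n => (q : ℍ[ℝ]) ^ (n + 1) * h (n + 1) := (summable_nat_add_iff 1).2 hs
  rw [starMul, hf.coeffs_eq, (linFun_expansion a b).coeffs_eq, ← (hf q).tsum_eq]
  have hsum : HasSum (fun n => (q : ℍ[ℝ]) ^ (n + 1) * ∑ k ∈ Finset.range (n + 2), h k *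
      (fun n => if n = 0 then b else if n = 1 then a else 0) (n + 1 - k))
      ((∑' n, (q : ℍ[ℝ]) ^ (n + 1) * h (n + 1)) * b + q * (∑' n, (q : ℍ[ℝ]) ^ n * h n) * a) := by
    simp_rw [hconv]
    have e : (fun n => (q : ℍ[ℝ]) ^ (n + 1) * (h (n + 1) * b + h n * a)) =
        fun n => (q : ℍ[ℝ]) ^ (n + 1) * h (n + 1) * b + q * (q ^ n * h n) * a := by
      funext n
      rw [mul_add, pow_succ']
      simp only [mul_assoc]
    rw [e]
    exact (hs1.hasSum.mul_right b).add ((hs.hasSum.mul_left (q : ℍ[ℝ])).mul_right a)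
  have hsum' := (hasSum_nat_add_iff (f := fun n => (q : ℍ[ℝ]) ^ n * ∑ k ∈ Finset.range (n + 1), h k *
      (fun n => if n = 0 then b else if n = 1 then a else 0) (n - k)) 1).1 hsum
  rw [hsum'.tsum_eq, hs.tsum_eq_zero_add]
  simp [add_mul]
  abel

/-- The symmetrization of `l_{(c,d)}`, written out. -/
def fs (c d : ℍ[ℝ]) (q : ℍ[ℝ]) : ℍ[ℝ] :=
  q ^ 2 * ((Quaternion.normSq c : ℝ) : ℍ[ℝ]) + q * ((2 * (star c * d).re : ℝ) : ℍ[ℝ]) +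
    ((Quaternion.normSq d : ℝ) : ℍ[ℝ])

theorem star_mul_add (c d : ℍ[ℝ]) :
    star c * d + star d * c = ((2 * (star c * d).re : ℝ) : ℍ[ℝ]) := by
  ext <;> simp <;> ring

theorem mul_star_add (c d : ℍ[ℝ]) :
    c * star d + d * star c = ((2 * (star c * d).re : ℝ) : ℍ[ℝ]) := by
  ext <;> simp <;> ring

theorem symmetrization_linFun (c d : ℍ[ℝ]) (q : Ball) : symmetrization (linFun c d) q = fs c d q := by
  rw [symmetrization, linFun_regConj, starMul_linFun (linFun_expansion c d), fs, ← mul_star_add,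
    ← Quaternion.self_mul_star, ← Quaternion.self_mul_star, linFun]
  noncomm_ring

theorem fs_commute (c d q : ℍ[ℝ]) : fs c d q * q = q * fs c d q := by
  rw [fs]
  simp only [add_mul, mul_add]
  congr 1
  · congr 1
    · rw [mul_assoc, Quaternion.coe_commutes, ← mul_assoc, ← mul_assoc, pow_two, mul_assoc q q q]
    · rw [mul_assoc, Quaternion.coe_commutes]
  · rw [Quaternion.coe_commutes]

theorem fs_eq (c d q : ℍ[ℝ]) :
    fs c d q = (q * star c + star d) * d + q * (q * star c + star d) * c := by
  rw [fs, ← star_mul_add, ← Quaternion.star_mul_self, ← Quaternion.star_mul_self]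
  noncomm_ring

theorem linFun_star_ne {c d : ℍ[ℝ]} (h : ‖c‖ < ‖d‖) (q : Ball) :
    (q : ℍ[ℝ]) * star c + star d ≠ 0 := by
  intro h0
  have h1 : ‖(q : ℍ[ℝ])‖ * ‖c‖ = ‖d‖ := by
    rw [← norm_star c, ← norm_mul, ← norm_star d, ← norm_neg (star d), eq_neg_of_add_eq_zero_left h0]
  nlinarith [Ball.norm_lt q, norm_nonneg c, norm_nonneg (q : ℍ[ℝ])]

theorem starInv_expansion {c d : ℍ[ℝ]} (h : ‖c‖ < ‖d‖) :
    HasSliceExpansion (starInv (linFun c d)) (fun n => (-(d⁻¹ * c)) ^ n * d⁻¹) := by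
  intro q
  have hd : d ≠ 0 := by
    rintro rfl
    simp at h
    linarith [norm_nonneg c]
  set H : ℕ → ℍ[ℝ] := fun n => (-(d⁻¹ * c)) ^ n * d⁻¹ with hH
  have hr : ‖(q : ℍ[ℝ])‖ * ‖d⁻¹ * c‖ < 1 := by
    have : ‖d⁻¹ * c‖ < 1 := by
      rw [norm_mul, norm_inv, inv_mul_lt_one₀ (norm_pos_iff.2 hd)]
      exact h
    nlinarith [Ball.norm_lt q, norm_nonneg (q : ℍ[ℝ]), norm_nonneg (d⁻¹ * c)]
  have hsum : ∀ y : ℍ[ℝ], Summable fun n => (q : ℍ[ℝ]) ^ n * (y * H n) := by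
    intro y
    refine Summable.of_norm_bounded
      (((summable_geometric_of_lt_one (by positivity) hr).mul_left (‖y‖ * ‖d⁻¹‖))) fun n => ?_
    rw [norm_mul, norm_mul, hH, norm_mul, norm_pow, norm_pow, norm_neg, mul_pow]
    apply le_of_eq
    ring
  let U : ℍ[ℝ] → ℍ[ℝ] := fun y => ∑' n, (q : ℍ[ℝ]) ^ n * (y * H n)
  have hadd : ∀ y z, U (y + z) = U y + U z := by
    intro y z
    simp only [U]
    rw [← (hsum y).tsum_add (hsum z)]
    simp only [add_mul, mul_add]
  have hreal : ∀ r : ℝ, U (r : ℍ[ℝ]) = (r : ℍ[ℝ]) * U 1 := by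
    intro r
    simp only [U]
    rw [← (hsum 1).tsum_mul_left]
    refine tsum_congr fun n => ?_
    rw [← mul_assoc, ← Quaternion.coe_commutes, one_mul, mul_assoc]
  have hrec : ∀ y, U (y * d) = y - q * U (y * c) := by
    intro y
    simp only [U]
    rw [(hsum (y * d)).tsum_eq_zero_add, ← (hsum (y * c)).tsum_mul_left, sub_eq_add_neg, ← tsum_neg]
    congr 1
    · simp [hH, hd]
    · refine tsum_congr fun n => ?_
      have : d * H (n + 1) = - (c * H n) := by
        simp only [hH, pow_succ', mul_assoc]
        rw [neg_mul, mul_neg, mul_assoc, mul_inv_cancel_left₀ hd]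
      rw [mul_assoc y, this, pow_succ']
      simp only [mul_assoc, mul_neg]
  have hfs : fs c d q * U 1 = q * star c + star d := by
    have e1 := hrec (star c)
    have e2 := hrec (star d)
    rw [Quaternion.star_mul_self, hreal] at e1 e2
    have e3 := hreal (2 * (star c * d).re)
    rw [← star_mul_add, hadd, e1] at e3
    rw [fs, ← star_mul_add, add_mul, add_mul, mul_assoc, mul_assoc, ← e3, e2, pow_two, mul_assoc]
    noncomm_ring
  have hne : fs c d q ≠ 0 := by
    intro h0
    rw [h0, zero_mul] at hfs
    exact linFun_star_ne h q hfs.symm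
  have hS : starInv (linFun c d) q = U 1 := by
    rw [starInv, symmetrization_linFun, linFun_regConj, linFun, ← hfs, inv_mul_cancel_left₀ hne]
  rw [hS]
  have := (hsum 1).hasSum
  simpa [U] using this

theorem Sp11.norm_lt (A : Sp11) : ‖A.1 0 1‖ < ‖A.1 1 1‖ := by
  have := (Sp11.norm_rel A).2.1
  nlinarith [norm_nonneg (A.1 0 1), norm_nonneg (A.1 1 1)]

theorem mobiusFun_eq (A : Sp11) (q : Ball) :
    mobiusFun A q = (fs (A.1 0 1) (A.1 1 1) q)⁻¹ *
      ((q * star (A.1 0 1) + star (A.1 1 1)) * A.1 1 0 +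
        q * (q * star (A.1 0 1) + star (A.1 1 1)) * A.1 0 0) := by
  rw [mobiusFun, starMul_linFun (starInv_expansion (Sp11.norm_lt A)), starInv, symmetrization_linFun,
    linFun_regConj, linFun]
  have hc : (q : ℍ[ℝ]) * (fs (A.1 0 1) (A.1 1 1) q)⁻¹ = (fs (A.1 0 1) (A.1 1 1) q)⁻¹ * q :=
    (Commute.inv_left₀ (fs_commute (A.1 0 1) (A.1 1 1) q : Commute _ _)).eq.symm
  rw [← mul_assoc, hc]
  simp only [mul_add, add_mul, mul_assoc]

theorem mobiusFun_norm_lt (A : Sp11) (q : Ball) : ‖mobiusFun A q‖ < 1 := by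
  rw [mobiusFun_eq, fs_eq]
  have hk := linFun_star_ne (Sp11.norm_lt A) q
  set k := (q : ℍ[ℝ]) * star (A.1 0 1) + star (A.1 1 1) with hkdef
  obtain ⟨-, -, n1, n2⟩ := Sp11.norm_rel A
  have r2 := (Sp11.row_rel A).2.1
  have hq := Ball.norm_lt q
  have hq0 := norm_nonneg (q : ℍ[ℝ])
  have hk0 := norm_pos_iff.2 hk
  have key : ‖k * A.1 1 0 + q * k * A.1 0 0‖ ^ 2 < ‖k * A.1 1 1 + q * k * A.1 0 1‖ ^ 2 := by
    rw [norm_add_sq_real, norm_add_sq_real]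
    have hin : inner ℝ (k * A.1 1 0) (q * k * A.1 0 0) = inner ℝ (k * A.1 1 1) (q * k * A.1 0 1) := by
      rw [Quaternion.inner_def, Quaternion.inner_def]
      have r2' : A.1 1 0 * star (A.1 0 0) = A.1 1 1 * star (A.1 0 1) := by
        have := congrArg star r2
        simpa using this
      rw [star_mul (q * k : ℍ[ℝ]), star_mul (q * k : ℍ[ℝ]), mul_assoc, ← mul_assoc (A.1 1 0), r2']
      simp only [mul_assoc]
    rw [hin]
    simp only [norm_mul, mul_pow]
    have : ‖(q : ℍ[ℝ])‖ ^ 2 * ‖k‖ ^ 2 < ‖k‖ ^ 2 := by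
      have : ‖(q : ℍ[ℝ])‖ ^ 2 < 1 := by nlinarith
      have h2 : 0 < ‖k‖ ^ 2 := by positivity
      nlinarith
    have e1 : ‖A.1 0 0‖ ^ 2 = 1 + ‖A.1 0 1‖ ^ 2 := by linarith
    have e2 : ‖A.1 1 1‖ ^ 2 = 1 + ‖A.1 1 0‖ ^ 2 := by linarith
    rw [e1, e2]
    nlinarith
  have key' := lt_of_pow_lt_pow_left₀ 2 (norm_nonneg _) key
  rw [norm_mul, norm_inv, inv_mul_lt_one₀ (lt_of_le_of_lt (norm_nonneg _) key')]
  exact key'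

/-- `𝓕_A` as a map from the ball to itself. -/
def mobiusMap (A : Sp11) : Ball → Ball := fun q => ⟨mobiusFun A q, Ball.mem_iff.2 (mobiusFun_norm_lt A q)⟩


/-! ### The parametrization of `Sp(1,1)` by `𝔹 × Sp(1) × Sp(1)` -/

/-- The factor `(1 - |a|²)^{-1/2}`. -/
def scal (a : Ball) : ℝ := (√(1 - ‖(a : ℍ[ℝ])‖ ^ 2))⁻¹

theorem scal_pos (a : Ball) : 0 < scal a := by
  have := Ball.norm_lt a
  have h0 := norm_nonneg (a : ℍ[ℝ])
  exact inv_pos.2 (Real.sqrt_pos.2 (by nlinarith))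

theorem scal_sq (a : Ball) : scal a * scal a * (1 - ‖(a : ℍ[ℝ])‖ ^ 2) = 1 := by
  have := Ball.norm_lt a
  have h0 := norm_nonneg (a : ℍ[ℝ])
  have h1 : 0 < 1 - ‖(a : ℍ[ℝ])‖ ^ 2 := by nlinarith
  rw [scal, ← mul_inv, Real.mul_self_sqrt h1.le, inv_mul_cancel₀ h1.ne']

theorem Sp1.star_mul_self (u : Sp1) : star (u : ℍ[ℝ]) * u = 1 := by
  rw [Quaternion.star_mul_self, Quaternion.normSq_eq_norm_mul_self]
  simp

theorem Sp1.self_mul_star (u : Sp1) : (u : ℍ[ℝ]) * star (u : ℍ[ℝ]) = 1 := by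
  rw [Quaternion.self_mul_star, Quaternion.normSq_eq_norm_mul_self]
  simp

/-- The matrix `(1 - |a|²)^{-1/2} ((ū, conj(au)), (a, 1)) w` for `(a, u, w) ∈ 𝔹 × Sp(1) × Sp(1)`. -/
def paramMat (x : Ball × Sp1 × Sp1) : Mat2 :=
  scal x.1 • !![star (x.2.1 : ℍ[ℝ]) * x.2.2, star (x.2.1 : ℍ[ℝ]) * star (x.1 : ℍ[ℝ]) * x.2.2;
    (x.1 : ℍ[ℝ]) * x.2.2, x.2.2]

theorem paramMat_mem (x : Ball × Sp1 × Sp1) : paramMat x ∈ Sp11 := by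
  obtain ⟨a, u, w⟩ := x
  change (paramMat (a, u, w))ᴴ * I11 * paramMat (a, u, w) = I11
  have hu := Sp1.self_mul_star u
  have hw := Sp1.star_mul_self w
  have ha : star (a : ℍ[ℝ]) * a = ((‖(a : ℍ[ℝ])‖ ^ 2 : ℝ) : ℍ[ℝ]) := by
    rw [Quaternion.star_mul_self, Quaternion.normSq_eq_norm_mul_self, pow_two]
  have ha' : (a : ℍ[ℝ]) * star (a : ℍ[ℝ]) = ((‖(a : ℍ[ℝ])‖ ^ 2 : ℝ) : ℍ[ℝ]) := by
    rw [Quaternion.self_mul_star, Quaternion.normSq_eq_norm_mul_self, pow_two]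
  have hs := scal_sq a
  have hs' : (scal a * scal a) • ((1 : ℍ[ℝ]) - ((‖(a : ℍ[ℝ])‖ ^ 2 : ℝ) : ℍ[ℝ])) = 1 := by
    rw [← Quaternion.coe_one, ← Quaternion.coe_sub, ← Quaternion.coe_smul, smul_eq_mul, hs]
  have hr : ∀ r : ℝ, star (w : ℍ[ℝ]) * ((r : ℍ[ℝ]) * w) = r := fun r => by
    rw [Quaternion.coe_commutes, ← mul_assoc, hw, one_mul]
  have huu : ∀ y : ℍ[ℝ], (u : ℍ[ℝ]) * (star (u : ℍ[ℝ]) * y) = y := fun y => by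
    rw [← mul_assoc, hu, one_mul]
  have haa : ∀ y : ℍ[ℝ], star (a : ℍ[ℝ]) * (a * y) = ((‖(a : ℍ[ℝ])‖ ^ 2 : ℝ) : ℍ[ℝ]) * y := fun y => by
    rw [← mul_assoc, ha]
  have haa' : ∀ y : ℍ[ℝ], (a : ℍ[ℝ]) * (star (a : ℍ[ℝ]) * y) = ((‖(a : ℍ[ℝ])‖ ^ 2 : ℝ) : ℍ[ℝ]) * y := fun y => by
    rw [← mul_assoc, ha']
  refine Matrix.ext fun i j => ?_
  fin_cases i <;> fin_cases j
  · simp [paramMat, I11, Matrix.mul_apply, mul_assoc, smul_smul, huu, haa, hw, ← sub_eq_add_neg, ← smul_sub]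
    rw [← Quaternion.coe_pow, hr, hs']
  · simp [paramMat, I11, Matrix.mul_apply, mul_assoc, smul_smul, huu, ← sub_eq_add_neg]
  · simp [paramMat, I11, Matrix.mul_apply, mul_assoc, smul_smul, huu, ← sub_eq_add_neg]
  · simp [paramMat, I11, Matrix.mul_apply, mul_assoc, smul_smul, huu, haa', hw, ← sub_eq_add_neg, ← smul_sub]
    rw [← Quaternion.coe_pow, hr, ← neg_sub, smul_neg, hs']

/-- The bijection `𝔹 × Sp(1) × Sp(1) → Sp(1,1)`. -/
def param (x : Ball × Sp1 × Sp1) : Sp11 := ⟨paramMat x, paramMat_mem x⟩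

theorem Sp11.norm_eq (A : Sp11) : ‖A.1 0 0‖ = ‖A.1 1 1‖ := by
  obtain ⟨h1, h2, h3, h4⟩ := Sp11.norm_rel A
  have : ‖A.1 0 0‖ ^ 2 = ‖A.1 1 1‖ ^ 2 := by linarith
  exact (sq_eq_sq₀ (norm_nonneg _) (norm_nonneg _)).1 this

theorem Sp11.norm_pos (A : Sp11) : 0 < ‖A.1 1 1‖ := lt_of_le_of_lt (norm_nonneg _) (Sp11.norm_lt A)

theorem Sp11.ne_zero (A : Sp11) : A.1 1 1 ≠ 0 := norm_pos_iff.1 (Sp11.norm_pos A)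

/-- The inverse of `param`. -/
def paramInv (A : Sp11) : Ball × Sp1 × Sp1 :=
  (⟨A.1 1 0 * (A.1 1 1)⁻¹, Ball.mem_iff.2 (by
      have h := (Sp11.norm_rel A).2.2.2
      have hp := Sp11.norm_pos A
      rw [norm_mul, norm_inv, mul_inv_lt_iff₀ hp, one_mul]
      nlinarith [norm_nonneg (A.1 1 0)])⟩,
    ⟨(‖A.1 1 1‖ * ‖A.1 0 0‖)⁻¹ • (A.1 1 1 * star (A.1 0 0)), by
      have hp := Sp11.norm_pos A
      have hq := Sp11.norm_eq A
      rw [mem_sphere_zero_iff_norm, norm_smul, norm_mul, norm_star, norm_inv, norm_mul, norm_norm,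
        norm_norm, hq, inv_mul_cancel₀ (by positivity)]⟩,
    ⟨‖A.1 1 1‖⁻¹ • A.1 1 1, by
      have hp := Sp11.norm_pos A
      rw [mem_sphere_zero_iff_norm, norm_smul, norm_inv, norm_norm, inv_mul_cancel₀ hp.ne']⟩)

theorem param_paramInv (A : Sp11) : param (paramInv A) = A := by
  have hp := Sp11.norm_pos A
  have hne := Sp11.ne_zero A
  have hq := Sp11.norm_eq A
  have h4 := (Sp11.norm_rel A).2.2.2
  have hs : scal (paramInv A).1 = ‖A.1 1 1‖ := by
    have : 1 - ‖((paramInv A).1 : ℍ[ℝ])‖ ^ 2 = (‖A.1 1 1‖⁻¹) ^ 2 := by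
      simp only [paramInv, norm_mul, norm_inv]
      field_simp
      exact h4
    rw [scal, this, Real.sqrt_sq (by positivity), inv_inv]
  have hdd : star (A.1 1 1) * A.1 1 1 = ((‖A.1 1 1‖ * ‖A.1 1 1‖ : ℝ) : ℍ[ℝ]) := by
    rw [Quaternion.star_mul_self, Quaternion.normSq_eq_norm_mul_self]
  have hpp : A.1 0 0 * star (A.1 0 0) = ((‖A.1 1 1‖ * ‖A.1 1 1‖ : ℝ) : ℍ[ℝ]) := by
    rw [Quaternion.self_mul_star, Quaternion.normSq_eq_norm_mul_self, hq]
  have hrel := (Sp11.col_rel A).2.1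
  have hdne : star (A.1 1 1) ≠ 0 := by simpa using hne
  apply Subtype.ext
  refine Matrix.ext fun i j => ?_
  change paramMat (paramInv A) i j = A.1 i j
  rw [paramMat, hs]
  fin_cases i <;> fin_cases j
  · simp [paramInv, mul_assoc, smul_smul, hdd, hq]
    rw [← Quaternion.coe_mul, ← Quaternion.coe_commutes, Quaternion.coe_mul_eq_smul, smul_smul]
    field_simp
    simp
  · simp [paramInv, mul_assoc, smul_smul, hq, hdne]
    rw [← hrel, ← mul_assoc (A.1 0 0) (star (A.1 0 0)), hpp, Quaternion.coe_mul_eq_smul, smul_smul]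
    field_simp
    simp
  · simp [paramInv, mul_assoc, smul_smul, hp.ne', hne]
  · simp [paramInv, smul_smul, hp.ne']

theorem paramInv_param (x : Ball × Sp1 × Sp1) : paramInv (param x) = x := by
  obtain ⟨a, u, w⟩ := x
  have hs := scal_pos a
  have hw : ‖(w : ℍ[ℝ])‖ = 1 := by simp
  have hu : ‖(u : ℍ[ℝ])‖ = 1 := by simp
  have hwne : (w : ℍ[ℝ]) ≠ 0 := norm_pos_iff.1 (by rw [hw]; exact one_pos)
  have h11 : (param (a, u, w)).1 1 1 = scal a • (w : ℍ[ℝ]) := by simp [param, paramMat]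
  have h10 : (param (a, u, w)).1 1 0 = scal a • ((a : ℍ[ℝ]) * w) := by simp [param, paramMat]
  have h00 : (param (a, u, w)).1 0 0 = scal a • (star (u : ℍ[ℝ]) * w) := by simp [param, paramMat]
  refine Prod.ext (Subtype.ext ?_) (Prod.ext (Subtype.ext ?_) (Subtype.ext ?_))
  · simp only [paramInv, h11, h10]
    rw [smul_inv₀, smul_mul_smul_comm, mul_inv_cancel₀ hs.ne', one_smul, mul_assoc,
      mul_inv_cancel₀ hwne, mul_one]
  · simp only [paramInv, h11, h00, norm_smul, norm_mul, norm_star, hw, hu]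
    rw [Quaternion.star_smul, star_mul, star_star]
    rw [smul_mul_smul_comm, ← mul_assoc (w : ℍ[ℝ]), Sp1.self_mul_star w, one_mul, smul_smul]
    have e : (scal a * 1 * (scal a * 1))⁻¹ * (scal a * scal a) = 1 := by field_simp
    rw [Real.norm_of_nonneg hs.le, e, one_smul, one_mul]
  · simp only [paramInv, h11, norm_smul, hw, smul_smul]
    simp [abs_of_pos hs, hs.ne']

theorem continuous_scal : Continuous scal := by
  unfold scal
  refine Continuous.inv₀ (by fun_prop) fun a => ?_
  have := scal_pos a
  exact (inv_pos.1 this).ne'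

theorem continuous_param : Continuous param := by
  refine Continuous.subtype_mk ?_ _
  have := continuous_scal
  refine continuous_matrix fun i j => ?_
  unfold paramMat
  fin_cases i <;> fin_cases j <;> simp <;> fun_prop

theorem continuous_paramInv : Continuous paramInv := by
  have he : ∀ i j, Continuous fun A : Sp11 => A.1 i j := fun i j =>
    continuous_subtype_val.matrix_elem i j
  have h0 := he 0 0
  have h1 := he 1 0
  have h2 := he 1 1
  have hn : ∀ A : Sp11, ‖A.1 1 1‖ * ‖A.1 0 0‖ ≠ 0 := fun A => by
    rw [Sp11.norm_eq]; exact (mul_pos (Sp11.norm_pos A) (Sp11.norm_pos A)).ne'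
  refine Continuous.prodMk (Continuous.subtype_mk ?_ _)
    (Continuous.prodMk (Continuous.subtype_mk ?_ _) (Continuous.subtype_mk ?_ _))
  · exact h1.mul (h2.inv₀ Sp11.ne_zero)
  · exact ((h2.norm.mul h0.norm).inv₀ hn).smul (h2.mul h0.star)
  · exact (h2.norm.inv₀ fun A => (Sp11.norm_pos A).ne').smul h2

/-- `param` is a homeomorphism onto `Sp(1,1)` with its subspace topology. -/
def paramHomeo : Ball × Sp1 × Sp1 ≃ₜ Sp11 where
  toFun := param
  invFun := paramInv
  left_inv := paramInv_param
  right_inv := param_paramInv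
  continuous_toFun := continuous_param
  continuous_invFun := continuous_paramInv

/-! ### Transport of a smooth structure along a homeomorphism -/

/-- The charts of `X` are the charts of `Y` composed with `e : X ≃ₜ Y`. -/
@[reducible] def transportChartedSpace {H X Y : Type*} [TopologicalSpace H] [TopologicalSpace X]
    [TopologicalSpace Y] [ChartedSpace H Y] (e : X ≃ₜ Y) : ChartedSpace H X where
  atlas := {c | ∃ c' ∈ atlas H Y, c = e.toOpenPartialHomeomorph.trans c'}
  chartAt x := e.toOpenPartialHomeomorph.trans (chartAt H (e x))
  mem_chart_source x := by simp
  chart_mem_atlas x := ⟨_, chart_mem_atlas H (e x), rfl⟩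

theorem transport_isManifold {E H X Y : Type*} [NormedAddCommGroup E] [NormedSpace ℝ E]
    [TopologicalSpace H] [TopologicalSpace X] [TopologicalSpace Y] [ChartedSpace H Y]
    (I : ModelWithCorners ℝ E H) [hY : IsManifold I ∞ Y] (e : X ≃ₜ Y) :
    @IsManifold ℝ _ E _ _ H _ I ∞ X _ (transportChartedSpace e) := by
  let _ := transportChartedSpace (H := H) e
  have : HasGroupoid X (contDiffGroupoid ∞ I) := by
    refine ⟨?_⟩
    rintro _ _ ⟨c, hc, rfl⟩ ⟨c', hc', rfl⟩
    have h := HasGroupoid.compatible (G := contDiffGroupoid ∞ I) hc hc'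
    refine (contDiffGroupoid ∞ I).mem_of_eqOnSource h ?_
    refine ⟨?_, ?_⟩
    · ext x; simp
    · intro x hx; simp
  exact { toHasGroupoid := this }


/-! ### The set of regular Möbius transformations -/

theorem fs_ne_zero {c d : ℍ[ℝ]} (h : ‖c‖ < ‖d‖) (q : Ball) : fs c d q ≠ 0 := by
  intro h0
  have hk := norm_pos_iff.2 (linFun_star_ne h q)
  rw [fs_eq] at h0
  have h1 := congrArg norm (eq_neg_of_add_eq_zero_left h0)
  rw [norm_neg, norm_mul, norm_mul, norm_mul] at h1
  have hq := Ball.norm_lt q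
  have h2 := mul_lt_mul_of_pos_left h hk
  have h3 : ‖(q : ℍ[ℝ])‖ * ‖(q : ℍ[ℝ]) * star c + star d‖ * ‖c‖ ≤ 
    ‖(q : ℍ[ℝ]) * star c + star d‖ * ‖c‖ := by
    have := mul_le_mul_of_nonneg_right hq.le (mul_nonneg hk.le (norm_nonneg c))
    linarith
  linarith

/-- Denominator in an explicit form of `𝓕_A`. -/
def den (a q : ℍ[ℝ]) : ℍ[ℝ] := (1 - q * a) - q * (1 - q * a) * star a

/-- Numerator in an explicit form of `𝓕_A`. -/
def num (a q : ℍ[ℝ]) : ℍ[ℝ] := q * (1 - q * a) - (1 - q * a) * a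

theorem mobiusFun_param_aux (x : Ball × Sp1 × Sp1) (q : Ball) :
    den x.1 q ≠ 0 ∧ mobiusFun (param x)⁻¹ q = (den x.1 q)⁻¹ * num x.1 q * x.2.1 := by
  obtain ⟨a, u, w⟩ := x
  have hs := scal_pos a
  have hw := Sp1.self_mul_star w
  obtain ⟨i00, i01, i10, i11⟩ := Sp11.inv_apply (param (a, u, w))
  have h00 : (param (a, u, w))⁻¹.1 0 0 = scal a • (star (w : ℍ[ℝ]) * u) := by
    rw [i00]; simp [param, paramMat]
  have h01 : (param (a, u, w))⁻¹.1 0 1 = -(scal a • (star (w : ℍ[ℝ]) * star (a : ℍ[ℝ]))) := by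
    rw [i01]; simp [param, paramMat]
  have h10 : (param (a, u, w))⁻¹.1 1 0 = -(scal a • (star (w : ℍ[ℝ]) * (a * u))) := by
    rw [i10]; simp [param, paramMat]
  have h11 : (param (a, u, w))⁻¹.1 1 1 = scal a • star (w : ℍ[ℝ]) := by
    rw [i11]; simp [param, paramMat]
  have hk : (q : ℍ[ℝ]) * star ((param (a, u, w))⁻¹.1 0 1) + star ((param (a, u, w))⁻¹.1 1 1) =
      scal a • ((1 - q * a) * w) := by
    rw [h01, h11, star_neg, Quaternion.star_smul, Quaternion.star_smul, star_mul, star_star, star_star,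
      mul_neg, mul_smul_comm, sub_mul, one_mul, smul_sub, mul_assoc]
    abel
  have hww : ∀ y : ℍ[ℝ], (w : ℍ[ℝ]) * (star (w : ℍ[ℝ]) * y) = y := fun y => by
    rw [← mul_assoc, hw, one_mul]
  have hne := fs_ne_zero (Sp11.norm_lt (param (a, u, w))⁻¹) q
  have hfs : fs ((param (a, u, w))⁻¹.1 0 1) ((param (a, u, w))⁻¹.1 1 1) q =
      (scal a * scal a) • den a q := by
    rw [fs_eq, hk, h01, h11, den]
    simp only [mul_neg, mul_smul_comm, mul_assoc, hww, hw, smul_mul_assoc, smul_smul,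
      mul_one, smul_sub, ← sub_eq_add_neg]
  rw [hfs] at hne
  refine ⟨fun h => hne (by simp [h]), ?_⟩
  rw [mobiusFun_eq, hfs, hk, h00, h10]
  have : scal a • ((1 - (q : ℍ[ℝ]) * a) * w) * -(scal a • (star (w : ℍ[ℝ]) * (a * u))) +
      q * (scal a • ((1 - (q : ℍ[ℝ]) * a) * w)) * (scal a • (star (w : ℍ[ℝ]) * u)) =
      (scal a * scal a) • (num a q * u) := by
    rw [num]
    simp only [mul_neg, mul_smul_comm, mul_assoc, hww, smul_mul_assoc, smul_smul,
      mul_one, one_mul, smul_sub, sub_mul, mul_sub]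
    abel
  rw [this, smul_inv₀, smul_mul_smul_comm, inv_mul_cancel₀ (by positivity), one_smul, mul_assoc]

theorem den_ne_zero (a q : Ball) : den a q ≠ 0 := (mobiusFun_param_aux (a, 1, 1) q).1

theorem mobiusFun_param (x : Ball × Sp1 × Sp1) (q : Ball) :
    mobiusFun (param x)⁻¹ q = (den x.1 q)⁻¹ * num x.1 q * x.2.1 :=
  (mobiusFun_param_aux x q).2

theorem num_eq_zero {a q : Ball} (h : num a q = 0) : q = a := by
  have h1 : (q : ℍ[ℝ]) - a = q * (q - a) * a := by
    rw [← sub_eq_zero, ← h, num]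
    noncomm_ring
  have h2 := congrArg norm h1
  rw [norm_mul, norm_mul] at h2
  have hq := Ball.norm_lt q
  have ha := Ball.norm_lt a
  by_contra hne
  have h3 : 0 < ‖(q : ℍ[ℝ]) - a‖ := norm_pos_iff.2 (sub_ne_zero.2 fun h => hne (Subtype.ext h))
  have h4 : ‖(q : ℍ[ℝ])‖ * ‖(a : ℍ[ℝ])‖ < 1 := by
    nlinarith [norm_nonneg (q : ℍ[ℝ]), norm_nonneg (a : ℍ[ℝ])]
  nlinarith

theorem num_self (a : Ball) : num a a = 0 := by
  rw [num]; noncomm_ring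

/-- The origin of the ball. -/
instance : Zero Ball := ⟨⟨0, Ball.mem_iff.2 (by simp)⟩⟩

@[simp] theorem Ball.coe_zero : ((0 : Ball) : ℍ[ℝ]) = 0 := rfl

theorem Ball.exists_ne (a : Ball) : ∃ q : Ball, q ≠ a := by
  by_cases h : a = 0
  · refine ⟨⟨((1 / 2 : ℝ) : ℍ[ℝ]), Ball.mem_iff.2 (by rw [Quaternion.norm_coe]; norm_num)⟩, ?_⟩
    rw [h]
    intro h'
    have h2 : ‖((1 / 2 : ℝ) : ℍ[ℝ])‖ = ‖(0 : ℍ[ℝ])‖ := congrArg norm (congrArg Subtype.val h')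
    rw [Quaternion.norm_coe] at h2
    norm_num at h2
  · exact ⟨0, fun h' => h h'.symm⟩

/-- `𝓜(𝔹) = {𝓕_A : A ∈ Sp(1,1)}`, a set of maps from the ball to itself. -/
structure RegMobius where
  toFun : Ball → Ball
  exists_matrix : ∃ A : Sp11, mobiusMap A = toFun

theorem RegMobius.ext_fun {F G : RegMobius} (h : F.toFun = G.toFun) : F = G := by
  cases F; cases G; congr

/-- The natural map `Sp(1,1) → 𝓜(𝔹)`, `A ↦ 𝓕_{A⁻¹}`. -/
def toRegMobius (A : Sp11) : RegMobius := ⟨mobiusMap A⁻¹, A⁻¹, rfl⟩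

theorem toRegMobius_param (x : Ball × Sp1 × Sp1) (q : Ball) :
    (((toRegMobius (param x)).toFun q : Ball) : ℍ[ℝ]) = (den x.1 q)⁻¹ * num x.1 q * x.2.1 :=
  mobiusFun_param x q

theorem toRegMobius_param_eq (a : Ball) (u w w' : Sp1) :
    toRegMobius (param (a, u, w)) = toRegMobius (param (a, u, w')) :=
  RegMobius.ext_fun <| funext fun q => Subtype.ext <| by
    rw [toRegMobius_param, toRegMobius_param]

/-- The map `(a, u) ↦ (1 - q ā)^{-*} * (q - a) u` from `𝔹 × Sp(1)` to `𝓜(𝔹)`. -/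
def phiFun (x : Ball × Sp1) : RegMobius := toRegMobius (param (x.1, x.2, 1))

theorem phiFun_apply (x : Ball × Sp1) (q : Ball) :
    (((phiFun x).toFun q : Ball) : ℍ[ℝ]) = (den x.1 q)⁻¹ * num x.1 q * x.2 :=
  toRegMobius_param _ q

theorem toRegMobius_eq_phiFun (A : Sp11) :
    toRegMobius A = phiFun ((paramInv A).1, (paramInv A).2.1) := by
  conv_lhs => rw [← param_paramInv A]
  exact toRegMobius_param_eq _ _ _ _

theorem phiFun_bijective : Function.Bijective phiFun := by
  constructor
  · rintro ⟨a, u⟩ ⟨a', u'⟩ h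
    have hval : ∀ q : Ball, (den a q)⁻¹ * num a q * u = (den a' q)⁻¹ * num a' q * u' := fun q => by
      rw [← phiFun_apply (a, u), ← phiFun_apply (a', u'), h]
    have ha : a = a' := by
      have h1 := hval a
      rw [num_self, mul_zero, zero_mul] at h1
      have hu' : (u' : ℍ[ℝ]) ≠ 0 := norm_pos_iff.1 (by simp)
      have h2 := (mul_eq_zero.1 ((mul_eq_zero.1 h1.symm).resolve_right hu')).resolve_left
        (inv_ne_zero (den_ne_zero a' a))
      exact num_eq_zero h2
    subst ha
    obtain ⟨q, hq⟩ := Ball.exists_ne a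
    have hne : (den a q)⁻¹ * num a q ≠ 0 :=
      mul_ne_zero (inv_ne_zero (den_ne_zero a q)) fun h => hq (num_eq_zero h)
    exact Prod.ext rfl (Subtype.ext (mul_left_cancel₀ hne (hval q)))
  · rintro ⟨f, A, rfl⟩
    refine ⟨_, (toRegMobius_eq_phiFun A⁻¹).symm.trans ?_⟩
    exact RegMobius.ext_fun (by simp [toRegMobius])

/-- `phiFun` as a bijection. -/
def phi : Ball × Sp1 ≃ RegMobius := Equiv.ofBijective phiFun phiFun_bijective

/-- `𝓜(𝔹)` has the quotient topology of `Sp(1,1) → 𝓜(𝔹)`, `A ↦ 𝓕_{A⁻¹}`. -/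
instance : TopologicalSpace RegMobius := TopologicalSpace.coinduced toRegMobius inferInstance

/-- `phi` is a homeomorphism. -/
def phiHomeo : Ball × Sp1 ≃ₜ RegMobius where
  toEquiv := phi
  continuous_toFun := by
    have h : Continuous toRegMobius := continuous_coinduced_rng
    exact h.comp (continuous_param.comp (by fun_prop : Continuous fun x : Ball × Sp1 => (x.1, x.2, (1 : Sp1))))
  continuous_invFun := by
    refine continuous_coinduced_dom.2 ?_
    have : phi.symm ∘ toRegMobius = fun A => ((paramInv A).1, (paramInv A).2.1) := by
      funext A
      rw [Function.comp_apply, Equiv.symm_apply_eq]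
      exact toRegMobius_eq_phiFun A
    change Continuous (phi.symm ∘ toRegMobius)
    rw [this]
    exact (continuous_fst.comp continuous_paramInv).prodMk
      (continuous_fst.comp (continuous_snd.comp continuous_paramInv))

instance : T2Space RegMobius := phiHomeo.t2Space
instance : SecondCountableTopology RegMobius := phiHomeo.symm.secondCountableTopology

/-- `𝓜(𝔹)₀ = {𝓕 ∈ 𝓜(𝔹) : 𝓕(0) = 0}`, with the subspace topology. -/
def RegMobius₀ : Set RegMobius := {F | F.toFun 0 = 0}

theorem phi_mem (u : Sp1) : phi (0, u) ∈ RegMobius₀ := by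
  refine Subtype.ext ((phiFun_apply (0, u) 0).trans ?_)
  simp [num]

theorem phi_zero_apply (u : Sp1) (q : Ball) : ((phi (0, u)).toFun q : ℍ[ℝ]) = q * u :=
  (phiFun_apply (0, u) q).trans (by simp [num, den])

theorem mem_iff_phi (x : Ball × Sp1) : phi x ∈ RegMobius₀ ↔ x.1 = 0 := by
  constructor
  · intro h
    have h1 := (phiFun_apply x 0).symm.trans (congrArg Subtype.val h)
    have hu : (x.2 : ℍ[ℝ]) ≠ 0 := norm_pos_iff.1 (by simp)
    simpa [num, den, hu, Subtype.ext_iff] using h1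
  · intro h
    have : x = (0, x.2) := Prod.ext h rfl
    rw [this]
    exact phi_mem _

/-- `u ↦ R_u`, where `R_u(q) = q u`, is a homeomorphism `Sp(1) → 𝓜(𝔹)₀`. -/
def phi₀Homeo : Sp1 ≃ₜ RegMobius₀ where
  toFun u := ⟨phi (0, u), phi_mem u⟩
  invFun F := (phi.symm F).2
  left_inv u := by simp
  right_inv F := by
    apply Subtype.ext
    have h : phi (phi.symm F) ∈ RegMobius₀ := by simp
    have h0 := (mem_iff_phi _).1 h
    change phi (0, (phi.symm F).2) = F
    rw [← h0, Prod.mk.eta, Equiv.apply_symm_apply]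
  continuous_toFun := Continuous.subtype_mk (phiHomeo.continuous.comp (by fun_prop)) _
  continuous_invFun := continuous_snd.comp (phiHomeo.symm.continuous.comp continuous_subtype_val)

theorem phi_comp (v : Sp1) (x : Ball × Sp1) :
    (phi (0, v)).toFun ∘ (phi x).toFun = (phi (x.1, x.2 * v)).toFun := by
  funext q
  apply Subtype.ext
  rw [Function.comp_apply, phi_zero_apply]
  refine Eq.trans ?_ (phiFun_apply _ q).symm
  refine (congrArg (· * (v : ℍ[ℝ])) (phiFun_apply x q)).trans ?_
  simp [mul_assoc]

theorem comp_exists (F₀ : RegMobius₀) (F : RegMobius) :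
    ∃ A : Sp11, mobiusMap A = F₀.1.toFun ∘ F.toFun := by
  have h0 : F₀.1 = phi (0, phi₀Homeo.symm F₀) :=
    (congrArg Subtype.val (phi₀Homeo.apply_symm_apply F₀)).symm
  rw [h0, ← phi.apply_symm_apply F, phi_comp]
  exact (phi _).exists_matrix

/-- `𝓕₀ • 𝓕 = 𝓕₀ ∘ 𝓕`. -/
instance : SMul RegMobius₀ RegMobius where
  smul F₀ F := ⟨F₀.1.toFun ∘ F.toFun, comp_exists F₀ F⟩

/-- The product of `𝓜(𝔹)₀` is the composition of maps. -/
instance : Mul RegMobius₀ where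
  mul F G := ⟨F • G.1, by
    change F.1.toFun (G.1.toFun 0) = 0
    rw [show G.1.toFun 0 = 0 from G.2, show F.1.toFun 0 = 0 from F.2]⟩

theorem phi_one : (phi (0, 1)).toFun = id := by
  funext q
  exact Subtype.ext ((phi_zero_apply 1 q).trans (by simp))

/-- The neutral element of `𝓜(𝔹)₀` is the identity map. -/
instance : One RegMobius₀ where
  one := ⟨⟨id, phi_one ▸ (phi (0, 1)).exists_matrix⟩, rfl⟩

theorem phi₀_one : phi₀Homeo 1 = 1 := Subtype.ext (RegMobius.ext_fun phi_one)

theorem phi₀_mul (u v : Sp1) : phi₀Homeo u * phi₀Homeo v = phi₀Homeo (v * u) :=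
  Subtype.ext (RegMobius.ext_fun (phi_comp u (0, v)))

/-- `R_u⁻¹ = R_{u⁻¹}`. -/
instance : Inv RegMobius₀ where
  inv F := phi₀Homeo (phi₀Homeo.symm F)⁻¹

/-- `𝓜(𝔹)₀` is a group under composition. -/
instance : Group RegMobius₀ :=
  Group.ofLeftAxioms (fun _ _ _ => rfl) (fun _ => rfl) fun F => by
    change phi₀Homeo (phi₀Homeo.symm F)⁻¹ * F = 1
    conv_lhs => rw [← phi₀Homeo.apply_symm_apply F]
    rw [phi₀_mul, Homeomorph.symm_apply_apply, mul_inv_cancel, phi₀_one]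

/-- The action of `𝓜(𝔹)₀` on `𝓜(𝔹)` by composition. -/
instance : MulAction RegMobius₀ RegMobius where
  one_smul _ := rfl
  mul_smul _ _ _ := rfl

/-! ### Smooth structures

The charts below come from parametrizations. That they give the submanifold structure of `Sp(1,1)` in
`M₂(ℍ)`, the quotient structure of `𝓜(𝔹)` and the submanifold structure of `𝓜(𝔹)₀` in `𝓜(𝔹)` is
not built into the definitions: it is to be expressed with `IsEmbeddedSubmanifoldMap` and
`IsSmoothSubmersion`, which determine the structures. -/

/-- `ℝ³`. -/
abbrev E3 : Type := EuclideanSpace ℝ (Fin 3)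

/-- The model of the `10`-dimensional manifold `Sp(1,1)`. -/
abbrev modelSp11 := 𝓘(ℝ, ℍ[ℝ]).prod ((𝓡 3).prod (𝓡 3))

/-- The model of the `7`-dimensional manifold `𝓜(𝔹)`. -/
abbrev modelRegMobius := 𝓘(ℝ, ℍ[ℝ]).prod (𝓡 3)

instance : ChartedSpace (ModelProd ℍ[ℝ] (ModelProd E3 E3)) Sp11 :=
  transportChartedSpace paramHomeo.symm

instance : IsManifold modelSp11 ∞ Sp11 := transport_isManifold _ paramHomeo.symm

instance : ChartedSpace (ModelProd ℍ[ℝ] E3) RegMobius := transportChartedSpace phiHomeo.symm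

instance : IsManifold modelRegMobius ∞ RegMobius := transport_isManifold _ phiHomeo.symm

instance : ChartedSpace E3 RegMobius₀ := transportChartedSpace phi₀Homeo.symm

instance : IsManifold (𝓡 3) ∞ RegMobius₀ := transport_isManifold _ phi₀Homeo.symm

section

variable {E H M E' H' M' : Type*} [NormedAddCommGroup E] [NormedSpace ℝ E] [TopologicalSpace H]
  [TopologicalSpace M] [ChartedSpace H M] [NormedAddCommGroup E'] [NormedSpace ℝ E']
  [TopologicalSpace H'] [TopologicalSpace M'] [ChartedSpace H' M']

/-- `f` embeds the manifold `M` as an embedded submanifold of `M'`: it is smooth, a homeomorphism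
onto its image, and has injective differential at every point. -/
def IsEmbeddedSubmanifoldMap (I : ModelWithCorners ℝ E H) (I' : ModelWithCorners ℝ E' H')
    (f : M → M') : Prop :=
  ContMDiff I I' ∞ f ∧ Topology.IsEmbedding f ∧ ∀ x, Function.Injective (mfderiv I I' f x)

/-- `f` is a submersion: a surjective smooth map with surjective differential at every point. -/
def IsSmoothSubmersion (I : ModelWithCorners ℝ E H) (I' : ModelWithCorners ℝ E' H')
    (f : M → M') : Prop :=
  ContMDiff I I' ∞ f ∧ Function.Surjective f ∧ ∀ x, Function.Surjective (mfderiv I I' f x)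

end

/-- A proper action: for every compact `K` the set of `g` with `g K ∩ K ≠ ∅` is compact. -/
def IsProperAction (G X : Type*) [TopologicalSpace G] [TopologicalSpace X] [SMul G X] : Prop :=
  ∀ K : Set X, IsCompact K → IsCompact {g : G | ((fun x => g • x) '' K ∩ K).Nonempty}

/-- A free action: only the identity element fixes some point. -/
def IsFreeAction (G X : Type*) [One G] [SMul G X] : Prop :=
  ∀ (g : G) (x : X), g • x = x → g = 1

end SliceMobius

end

open SliceMobius

/-! Everything is read in coordinates. A matrix of Sp(1,1) is uniquely a triple (a, u, w) in 𝔹 ×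
Sp(1) × Sp(1). In the formula for `toRegMobius` (`toRegMobius_param`) the factor w cancels, while a
is the only zero of the transformation and u is then recovered from its value at any other point.
Hence 𝓜(𝔹) is 𝔹 × Sp(1), and A ↦ 𝓕_{A⁻¹} becomes the projection (a, u, w) ↦ (a, u). Fixing the
origin means a = 0, so 𝓜(𝔹)₀ consists of the maps R_v(q) = q v with v in Sp(1), and R_v ∘ 𝓕_{(a,u)}
= 𝓕_{(a,uv)} (`phi_comp`). The action is thus right translation on the second factor: smooth because
quaternionic multiplication is, free by cancellation in Sp(1), and proper because Sp(1) is compact.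

The charts are transported along these parametrizations, which therefore become diffeomorphisms
(`contMDiff_transport`, `contMDiff_transport_symm`). It remains to see that the resulting structures
are the intended ones. For Sp(1,1) in M₂(ℍ), the formulas for (a, u, w) make sense for ambient
matrices near Sp(1,1), which forces the inclusion to have injective differential
(`isEmbeddedSubmanifoldMap_sp11`). The submersion follows from smooth sections through every point
(`isSmoothSubmersion_toRegMobius`), and the embedding of 𝓜(𝔹)₀ from a smooth retraction
(`isEmbeddedSubmanifoldMap_regMobius₀`). -/

noncomputable section

namespace SliceMobius

/-! ### Transported charts: the homeomorphism becomes a diffeomorphism -/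

section Transport

variable {E H X Y : Type*} [NormedAddCommGroup E] [NormedSpace ℝ E]
  [TopologicalSpace H] [TopologicalSpace X] [TopologicalSpace Y] [ChartedSpace H Y]

/-- Near x the map `e` is the transported chart at x followed by the inverse of the chart of `Y` at
`e x`, and both are smooth. -/
theorem contMDiff_transport (I : ModelWithCorners ℝ E H) [IsManifold I ∞ Y] (e : X ≃ₜ Y) :
    letI := transportChartedSpace (H := H) e
    ContMDiff I I ∞ e := by
  let _ := transportChartedSpace (H := H) e
  have := transport_isManifold I e
  intro x
  have h1 : ContMDiffAt I I ∞ (chartAt H x) x :=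
    (contMDiffOn_chart (I := I) (n := ∞) (x := x)).contMDiffAt
      ((chartAt H x).open_source.mem_nhds (mem_chart_source H x))
  have h2 : ContMDiffAt I I ∞ (chartAt H (e x)).symm (chartAt H x x) :=
    (contMDiffOn_chart_symm (I := I) (n := ∞) (x := e x)).contMDiffAt
      ((chartAt H (e x)).open_target.mem_nhds (mem_chart_target H (e x)))
  refine (ContMDiffAt.comp x h2 h1).congr_of_eventuallyEq ?_
  filter_upwards [(chartAt H x).open_source.mem_nhds (mem_chart_source H x)] with y hy
  have hy' : e y ∈ (chartAt H (e x)).source := by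
    have hy2 : y ∈ (e.toOpenPartialHomeomorph.trans (chartAt H (e x))).source := hy
    simpa using hy2
  exact ((chartAt H (e x)).left_inv hy').symm

theorem contMDiff_transport_symm (I : ModelWithCorners ℝ E H) [IsManifold I ∞ Y] (e : X ≃ₜ Y) :
    letI := transportChartedSpace (H := H) e
    ContMDiff I I ∞ e.symm := by
  let _ := transportChartedSpace (H := H) e
  have := transport_isManifold I e
  intro y
  have h1 : ContMDiffAt I I ∞ (chartAt H y) y :=
    (contMDiffOn_chart (I := I) (n := ∞) (x := y)).contMDiffAt
      ((chartAt H y).open_source.mem_nhds (mem_chart_source H y))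
  -- The transported chart at `e.symm y` is `e` followed by the chart of `Y` at `e (e.symm y) = y`,
  -- so precomposing it with `e.symm` gives back the chart of `Y` at y.
  have hc : ∀ z, (chartAt H (e.symm y)) (e.symm z) = chartAt H y z := by
    intro z
    change (chartAt H (e (e.symm y))) (e (e.symm z)) = _
    rw [e.apply_symm_apply, e.apply_symm_apply]
  have h2 : ContMDiffAt I I ∞ (chartAt H (e.symm y)).symm (chartAt H y y) := by
    rw [← hc y]
    exact (contMDiffOn_chart_symm (I := I) (n := ∞) (x := e.symm y)).contMDiffAt
      ((chartAt H (e.symm y)).open_target.mem_nhds (mem_chart_target H (e.symm y)))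
  refine (ContMDiffAt.comp y h2 h1).congr_of_eventuallyEq ?_
  have hs : ∀ᶠ z in nhds y, e.symm z ∈ (chartAt H (e.symm y)).source :=
    e.symm.continuous.continuousAt ((chartAt H (e.symm y)).open_source.mem_nhds
      (mem_chart_source H (e.symm y)))
  filter_upwards [hs] with z hz
  rw [Function.comp_apply, ← hc z]
  exact ((chartAt H (e.symm y)).left_inv hz).symm

end Transport

theorem contMDiff_param : ContMDiff modelSp11 modelSp11 ∞ paramHomeo :=
  contMDiff_transport_symm modelSp11 paramHomeo.symm

theorem contMDiff_paramInv : ContMDiff modelSp11 modelSp11 ∞ paramHomeo.symm :=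
  contMDiff_transport modelSp11 paramHomeo.symm

theorem contMDiff_phi : ContMDiff modelRegMobius modelRegMobius ∞ phiHomeo :=
  contMDiff_transport_symm modelRegMobius phiHomeo.symm

theorem contMDiff_phi_symm : ContMDiff modelRegMobius modelRegMobius ∞ phiHomeo.symm :=
  contMDiff_transport modelRegMobius phiHomeo.symm

theorem contMDiff_phi₀ : ContMDiff (𝓡 3) (𝓡 3) ∞ phi₀Homeo :=
  contMDiff_transport_symm (𝓡 3) phi₀Homeo.symm

theorem contMDiff_phi₀_symm : ContMDiff (𝓡 3) (𝓡 3) ∞ phi₀Homeo.symm :=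
  contMDiff_transport (𝓡 3) phi₀Homeo.symm

/-! ### Smooth quaternionic operations on the ball and the sphere -/

section Quaternion

variable {E H M : Type*} [NormedAddCommGroup E] [NormedSpace ℝ E] [TopologicalSpace H]
  [TopologicalSpace M] [ChartedSpace H M] {I : ModelWithCorners ℝ E H}

theorem contMDiff_quaternion_mul {f g : M → ℍ[ℝ]} (hf : ContMDiff I 𝓘(ℝ, ℍ[ℝ]) ∞ f)
    (hg : ContMDiff I 𝓘(ℝ, ℍ[ℝ]) ∞ g) : ContMDiff I 𝓘(ℝ, ℍ[ℝ]) ∞ fun x => f x * g x :=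
  (contDiff_mul (𝕜 := ℝ) (𝔸 := ℍ[ℝ])).contMDiff.comp (hf.prodMk_space hg)

/-- Conjugation is real linear on a finite-dimensional space, hence continuous linear. -/
theorem contDiff_quaternion_star : ContDiff ℝ ∞ (star : ℍ[ℝ] → ℍ[ℝ]) :=
  (LinearMap.toContinuousLinearMap
    { toFun := star, map_add' := star_add, map_smul' := Quaternion.star_smul } :
      ℍ[ℝ] →L[ℝ] ℍ[ℝ]).contDiff

theorem contMDiff_quaternion_star {f : M → ℍ[ℝ]} (hf : ContMDiff I 𝓘(ℝ, ℍ[ℝ]) ∞ f) :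
    ContMDiff I 𝓘(ℝ, ℍ[ℝ]) ∞ fun x => star (f x) :=
  contDiff_quaternion_star.contMDiff.comp hf

/-- In a division ring inversion is `Ring.inverse`, which is smooth at every unit of a complete
normed algebra. -/
theorem contDiffAt_quaternion_inv {x : ℍ[ℝ]} (hx : x ≠ 0) :
    ContDiffAt ℝ ∞ (fun y : ℍ[ℝ] => y⁻¹) x := by
  have h := contDiffAt_ringInverse ℝ (n := ∞) (Units.mk0 x hx)
  rwa [Ring.inverse_eq_inv'] at h

theorem contMDiff_sp1_val : ContMDiff (𝓡 3) 𝓘(ℝ, ℍ[ℝ]) ∞ (Subtype.val : Sp1 → ℍ[ℝ]) :=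
  contMDiff_coe_sphere

theorem contMDiff_ball_val : ContMDiff 𝓘(ℝ, ℍ[ℝ]) 𝓘(ℝ, ℍ[ℝ]) ∞ (Subtype.val : Ball → ℍ[ℝ]) :=
  contMDiff_subtype_val

/-- The product is smooth as a map into ℍ, and a smooth map into ℍ with values in the sphere is
smooth into the sphere. -/
theorem contMDiff_sp1_mul [IsManifold I ∞ M] {f g : M → Sp1} (hf : ContMDiff I (𝓡 3) ∞ f)
    (hg : ContMDiff I (𝓡 3) ∞ g) : ContMDiff I (𝓡 3) ∞ fun x => f x * g x :=
  ContMDiff.codRestrict_sphere (contMDiff_quaternion_mul (contMDiff_sp1_val.comp hf)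
    (contMDiff_sp1_val.comp hg)) fun x => (f x * g x).2

theorem Sp1.coe_inv (u : Sp1) : ((u⁻¹ : Sp1) : ℍ[ℝ]) = star (u : ℍ[ℝ]) :=
  inv_eq_of_mul_eq_one_left (Sp1.star_mul_self u)

/-- On unit quaternions inversion is conjugation, so smoothness is again inherited from ℍ. -/
theorem contMDiff_sp1_inv [IsManifold I ∞ M] {f : M → Sp1} (hf : ContMDiff I (𝓡 3) ∞ f) :
    ContMDiff I (𝓡 3) ∞ fun x => (f x)⁻¹ := by
  have h := ContMDiff.codRestrict_sphere (n := 3)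
    (contMDiff_quaternion_star (contMDiff_sp1_val.comp hf)) fun x => by
      simp
  refine h.congr fun x => Subtype.ext (Sp1.coe_inv (f x))

end Quaternion

/-! ### Smoothness of the parametrization of Sp(1,1) -/

theorem contMDiff_scal : ContMDiff 𝓘(ℝ, ℍ[ℝ]) 𝓘(ℝ, ℝ) ∞ scal := by
  intro a
  -- The square root is smooth only away from 0; if the radicand vanished, `scal_sq` would read 0 =
  -- 1.
  have hne : 1 - ‖(a : ℍ[ℝ])‖ ^ 2 ≠ 0 := fun h => by
    have := scal_sq a
    rw [h, mul_zero] at this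
    exact zero_ne_one this
  have hs : √(1 - ‖(a : ℍ[ℝ])‖ ^ 2) ≠ 0 := (inv_pos.1 (scal_pos a)).ne'
  have h : ContDiffAt ℝ ∞ (fun x : ℍ[ℝ] => (√(1 - ‖x‖ ^ 2))⁻¹) (a : ℍ[ℝ]) :=
    ((contDiffAt_const.sub (contDiff_norm_sq ℝ).contDiffAt).sqrt hne).inv hs
  exact ContMDiffAt.comp (g := fun x : ℍ[ℝ] => (√(1 - ‖x‖ ^ 2))⁻¹) a h.contMDiffAt
    (contMDiff_ball_val a)

/-- Matrices are read as functions of two indices, a normed space in which smoothness can be checked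
entry by entry; each entry is built from `scal`, products and conjugates. -/
theorem contMDiff_paramMat : ContMDiff modelSp11 𝓘(ℝ, Fin 2 → Fin 2 → ℍ[ℝ]) ∞
    (fun (x : Ball × Sp1 × Sp1) (i j : Fin 2) => paramMat x i j) := by
  have ha : ContMDiff modelSp11 𝓘(ℝ, ℍ[ℝ]) ∞ fun x : Ball × Sp1 × Sp1 => (x.1 : ℍ[ℝ]) :=
    contMDiff_ball_val.comp contMDiff_fst
  have hu : ContMDiff modelSp11 𝓘(ℝ, ℍ[ℝ]) ∞ fun x : Ball × Sp1 × Sp1 => (x.2.1 : ℍ[ℝ]) :=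
    contMDiff_sp1_val.comp (contMDiff_fst.comp contMDiff_snd)
  have hw : ContMDiff modelSp11 𝓘(ℝ, ℍ[ℝ]) ∞ fun x : Ball × Sp1 × Sp1 => (x.2.2 : ℍ[ℝ]) :=
    contMDiff_sp1_val.comp (contMDiff_snd.comp contMDiff_snd)
  have hs : ContMDiff modelSp11 𝓘(ℝ, ℝ) ∞ fun x : Ball × Sp1 × Sp1 => scal x.1 :=
    contMDiff_scal.comp contMDiff_fst
  refine contMDiff_pi_space.2 fun i => contMDiff_pi_space.2 fun j => ?_
  fin_cases i <;> fin_cases j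
  · exact hs.smul (contMDiff_quaternion_mul (contMDiff_quaternion_star hu) hw)
  · exact hs.smul (contMDiff_quaternion_mul (contMDiff_quaternion_mul
      (contMDiff_quaternion_star hu) (contMDiff_quaternion_star ha)) hw)
  · exact hs.smul (contMDiff_quaternion_mul ha hw)
  · exact hs.smul hw

/-! ### Differentials of maps with a one-sided inverse -/

section Differential

variable {E H M E' H' M' E'' H'' M'' : Type*} [NormedAddCommGroup E] [NormedSpace ℝ E]
  [TopologicalSpace H] [TopologicalSpace M] [ChartedSpace H M] [NormedAddCommGroup E']
  [NormedSpace ℝ E'] [TopologicalSpace H'] [TopologicalSpace M'] [ChartedSpace H' M']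
  [NormedAddCommGroup E''] [NormedSpace ℝ E''] [TopologicalSpace H''] [TopologicalSpace M'']
  [ChartedSpace H'' M'']
  {I : ModelWithCorners ℝ E H} {I' : ModelWithCorners ℝ E' H'} {I'' : ModelWithCorners ℝ E'' H''}

/-- By the chain rule the kernel of the differential of `f` lies in that of `g ∘ f`. -/
theorem mfderiv_injective_of_comp {f : M → M'} {g : M' → M''} {x : M}
    (hg : MDifferentiableAt I' I'' g (f x)) (hf : MDifferentiableAt I I' f x)
    (h : Function.Injective (mfderiv I I'' (g ∘ f) x)) : Function.Injective (mfderiv I I' f x) := by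
  intro v w hvw
  apply h
  rw [mfderiv_comp_apply x hg hf, mfderiv_comp_apply x hg hf, hvw]

theorem mfderiv_injective_of_leftInverse {f : M → M'} {g : M' → M} {x : M}
    (hg : MDifferentiableAt I' I g (f x)) (hf : MDifferentiableAt I I' f x)
    (h : Function.LeftInverse g f) : Function.Injective (mfderiv I I' f x) := by
  refine mfderiv_injective_of_comp hg hf ?_
  rw [h.comp_eq_id, mfderiv_id]
  exact fun _ _ h => h

/-- The differential of the section `g` is a right inverse of that of `f`. This works only at the
points `g y`, so a submersion needs a section through each point. -/
theorem mfderiv_surjective_of_rightInverse {f : M → M'} {g : M' → M} {y : M'}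
    (hf : MDifferentiableAt I I' f (g y)) (hg : MDifferentiableAt I' I g y)
    (h : Function.RightInverse g f) : Function.Surjective (mfderiv I I' f (g y)) := by
  have hc := mfderiv_comp y hf hg
  rw [h.comp_eq_id, mfderiv_id] at hc
  intro v
  exact ⟨mfderiv I' I g y (show TangentSpace I' y from v), (DFunLike.congr_fun hc v).symm⟩

end Differential

/-! ### Sp(1,1) as an embedded submanifold of M₂(ℍ) -/

theorem mfderiv_ball_val_injective (a : Ball) :
    Function.Injective (mfderiv 𝓘(ℝ, ℍ[ℝ]) 𝓘(ℝ, ℍ[ℝ]) (Subtype.val : Ball → ℍ[ℝ]) a) := by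
  classical
  -- The value 0 outside the ball is harmless: the ball is open and `r` is differentiated only at
  -- its points.
  let r : ℍ[ℝ] → Ball := fun x => if h : x ∈ Ball then ⟨x, h⟩ else 0
  have hr : Function.LeftInverse r (Subtype.val : Ball → ℍ[ℝ]) := fun b => dif_pos b.2
  have hd : ContMDiffAt 𝓘(ℝ, ℍ[ℝ]) 𝓘(ℝ, ℍ[ℝ]) ∞ r (a : ℍ[ℝ]) := by
    refine contMDiffAt_subtype_iff.1 ?_
    have : (fun b : Ball => r b) = id := funext hr
    rw [this]
    exact contMDiffAt_id
  exact mfderiv_injective_of_leftInverse (hd.mdifferentiableAt (by simp))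
    ((contMDiff_ball_val a).mdifferentiableAt (by simp)) hr

theorem mfderiv_sp1_val_injective (u : Sp1) :
    Function.Injective (mfderiv (𝓡 3) 𝓘(ℝ, ℍ[ℝ]) (Subtype.val : Sp1 → ℍ[ℝ]) u) :=
  injective_mvfderiv_subtypeVal_sphere (E := ℍ[ℝ]) (n := 3) u

theorem mfderiv_prod_val_injective (x : Ball × Sp1 × Sp1) :
    Function.Injective (mfderiv modelSp11 (𝓘(ℝ, ℍ[ℝ]).prod (𝓘(ℝ, ℍ[ℝ]).prod 𝓘(ℝ, ℍ[ℝ])))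
      (Prod.map (Subtype.val : Ball → ℍ[ℝ])
        (Prod.map (Subtype.val : Sp1 → ℍ[ℝ]) (Subtype.val : Sp1 → ℍ[ℝ]))) x) := by
  have h2 : ∀ u : Sp1, MDifferentiableAt (𝓡 3) 𝓘(ℝ, ℍ[ℝ]) (Subtype.val : Sp1 → ℍ[ℝ]) u :=
    fun u => (contMDiff_sp1_val u).mdifferentiableAt (by simp)
  have h1 := (contMDiff_ball_val x.1).mdifferentiableAt (by simp)
  rw [mfderiv_prodMap h1 ((h2 _).prodMap (h2 _)), mfderiv_prodMap (h2 _) (h2 _)]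
  exact (mfderiv_ball_val_injective _).prodMap
    ((mfderiv_sp1_val_injective _).prodMap (mfderiv_sp1_val_injective _))

/-- The rational expressions in the entries of a matrix that occur in `paramInv`. -/
def paramInvExt (A : Fin 2 → Fin 2 → ℍ[ℝ]) : ℍ[ℝ] × ℍ[ℝ] × ℍ[ℝ] :=
  (A 1 0 * (A 1 1)⁻¹, (‖A 1 1‖ * ‖A 0 0‖)⁻¹ • (A 1 1 * star (A 0 0)), ‖A 1 1‖⁻¹ • A 1 1)

/-- The norm and the inverse are differentiable away from 0, and only the diagonal entries are
inverted or normed. The point is to have the coordinates of `paramInv` differentiable on the ambient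
space, independently of the charts of Sp(1,1). -/
theorem mdifferentiableAt_paramInvExt {A : Fin 2 → Fin 2 → ℍ[ℝ]} (h0 : A 0 0 ≠ 0)
    (h1 : A 1 1 ≠ 0) : MDifferentiableAt 𝓘(ℝ, Fin 2 → Fin 2 → ℍ[ℝ])
      (𝓘(ℝ, ℍ[ℝ]).prod (𝓘(ℝ, ℍ[ℝ]).prod 𝓘(ℝ, ℍ[ℝ]))) paramInvExt A := by
  have he : ∀ i j, ContDiffAt ℝ ∞ (fun B : Fin 2 → Fin 2 → ℍ[ℝ] => B i j) A :=
    fun i j => contDiffAt_pi.1 (contDiffAt_pi.1 contDiffAt_id i) j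
  have n0 := (he 0 0).norm ℝ h0
  have n1 := (he 1 1).norm ℝ h1
  have hi : ContDiffAt ℝ ∞ (fun B : Fin 2 → Fin 2 → ℍ[ℝ] => (B 1 1)⁻¹) A :=
    ContDiffAt.comp (g := fun y : ℍ[ℝ] => y⁻¹) A (contDiffAt_quaternion_inv h1) (he 1 1)
  have c1 := ((he 1 0).mul hi).contMDiffAt.mdifferentiableAt (by simp)
  have c2 := (((n1.mul n0).inv (mul_ne_zero (norm_ne_zero_iff.2 h1) (norm_ne_zero_iff.2 h0))).smul
    ((he 1 1).mul (contDiff_quaternion_star.contDiffAt.comp A (he 0 0)))).contMDiffAt.mdifferentiableAt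
      (by simp)
  have c3 := ((n1.inv (norm_ne_zero_iff.2 h1)).smul (he 1 1)).contMDiffAt.mdifferentiableAt (by simp)
  exact c1.prodMk (c2.prodMk c3)

/-- The differential is injective because following the inclusion by `paramInvExt` gives the
coordinate map `paramHomeo.symm` followed by the inclusion of 𝔹 × Sp(1) × Sp(1) in ℍ³, both of which
have injective differentials. -/
theorem isEmbeddedSubmanifoldMap_sp11 :
    IsEmbeddedSubmanifoldMap modelSp11 𝓘(ℝ, Fin 2 → Fin 2 → ℍ[ℝ])
      (fun (A : Sp11) (i j : Fin 2) => A.1 i j) := by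
  have hsm : ContMDiff modelSp11 𝓘(ℝ, Fin 2 → Fin 2 → ℍ[ℝ]) ∞
      (fun (A : Sp11) (i j : Fin 2) => A.1 i j) := by
    refine (contMDiff_paramMat.comp contMDiff_paramInv).congr fun A => ?_
    funext i j
    exact congrArg (fun B : Sp11 => B.1 i j) (param_paramInv A).symm
  refine ⟨hsm, Topology.IsEmbedding.subtypeVal, fun A => ?_⟩
  -- The two diagonal entries have the same norm, which is positive.
  have h0 : A.1 0 0 ≠ 0 := norm_pos_iff.1 (by rw [Sp11.norm_eq]; exact Sp11.norm_pos A)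
  refine mfderiv_injective_of_comp (mdifferentiableAt_paramInvExt h0 (Sp11.ne_zero A))
    ((hsm A).mdifferentiableAt (by simp)) ?_
  have hinv := (contMDiff_paramInv A).mdifferentiableAt (by simp)
  have hval : MDifferentiableAt modelSp11 (𝓘(ℝ, ℍ[ℝ]).prod (𝓘(ℝ, ℍ[ℝ]).prod 𝓘(ℝ, ℍ[ℝ])))
      (Prod.map (Subtype.val : Ball → ℍ[ℝ])
        (Prod.map (Subtype.val : Sp1 → ℍ[ℝ]) (Subtype.val : Sp1 → ℍ[ℝ]))) (paramHomeo.symm A) :=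
    ((contMDiff_ball_val _).mdifferentiableAt (by simp)).prodMap
      (((contMDiff_sp1_val _).mdifferentiableAt (by simp)).prodMap
        ((contMDiff_sp1_val _).mdifferentiableAt (by simp)))
  have hcomp : paramInvExt ∘ (fun (A : Sp11) (i j : Fin 2) => A.1 i j) =
      Prod.map (Subtype.val : Ball → ℍ[ℝ])
        (Prod.map (Subtype.val : Sp1 → ℍ[ℝ]) (Subtype.val : Sp1 → ℍ[ℝ])) ∘ paramHomeo.symm := rfl
  rw [hcomp, mfderiv_comp A hval hinv]
  exact (mfderiv_prod_val_injective _).comp (mfderiv_injective_of_leftInverse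
    ((contMDiff_param _).mdifferentiableAt (by simp)) hinv paramHomeo.apply_symm_apply)

/-! ### The structures on 𝓜(𝔹) and 𝓜(𝔹)₀ -/

theorem isSmoothSubmersion_toRegMobius :
    IsSmoothSubmersion modelSp11 modelRegMobius toRegMobius := by
  have hsm : ContMDiff modelSp11 modelRegMobius ∞ toRegMobius := by
    -- In coordinates the map forgets w.
    have h : ContMDiff modelSp11 modelRegMobius ∞
        fun A : Sp11 => phiHomeo ((paramHomeo.symm A).1, (paramHomeo.symm A).2.1) :=
      contMDiff_phi.comp ((contMDiff_fst.comp contMDiff_paramInv).prodMk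
        (contMDiff_fst.comp (contMDiff_snd.comp contMDiff_paramInv)))
    exact h.congr toRegMobius_eq_phiFun
  -- Each w gives a global section (a, u) ↦ (a, u, w); together their images cover Sp(1,1).
  let s : Sp1 → RegMobius → Sp11 := fun w F =>
    paramHomeo ((phiHomeo.symm F).1, (phiHomeo.symm F).2, w)
  have hs : ∀ w, ContMDiff modelRegMobius modelSp11 ∞ (s w) := fun w =>
    contMDiff_param.comp ((contMDiff_fst.comp contMDiff_phi_symm).prodMk
      ((contMDiff_snd.comp contMDiff_phi_symm).prodMk contMDiff_const))
  have hr : ∀ w, Function.RightInverse (s w) toRegMobius := fun w F =>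
    (toRegMobius_param_eq _ _ w 1).trans (phiHomeo.apply_symm_apply F)
  refine ⟨hsm, (hr 1).surjective, fun A => ?_⟩
  -- The section whose w is the third coordinate of A passes through A.
  have hA : s (paramHomeo.symm A).2.2 (toRegMobius A) = A := by
    have h : phiHomeo.symm (toRegMobius A) =
        ((paramHomeo.symm A).1, (paramHomeo.symm A).2.1) := by
      rw [toRegMobius_eq_phiFun]
      exact phiHomeo.symm_apply_apply _
    change paramHomeo ((phiHomeo.symm (toRegMobius A)).1, (phiHomeo.symm (toRegMobius A)).2, _) = A
    rw [h]
    exact paramHomeo.apply_symm_apply A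
  rw [← hA]
  exact mfderiv_surjective_of_rightInverse ((hsm _).mdifferentiableAt (by simp))
    ((hs _ _).mdifferentiableAt (by simp)) (hr _)

/-- In coordinates this is the inclusion of {0} × Sp(1), and (a, u) ↦ R_u is a smooth left inverse
defined on all of 𝓜(𝔹). -/
theorem isEmbeddedSubmanifoldMap_regMobius₀ :
    IsEmbeddedSubmanifoldMap (𝓡 3) modelRegMobius (Subtype.val : RegMobius₀ → RegMobius) := by
  have hsm : ContMDiff (𝓡 3) modelRegMobius ∞ (Subtype.val : RegMobius₀ → RegMobius) := by
    have h : ContMDiff (𝓡 3) modelRegMobius ∞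
        fun F : RegMobius₀ => phiHomeo ((0 : Ball), phi₀Homeo.symm F) :=
      contMDiff_phi.comp (contMDiff_const.prodMk contMDiff_phi₀_symm)
    exact h.congr fun F => (congrArg Subtype.val (phi₀Homeo.apply_symm_apply F)).symm
  have hr : ContMDiff modelRegMobius (𝓡 3) ∞ fun F => phi₀Homeo (phiHomeo.symm F).2 :=
    contMDiff_phi₀.comp (contMDiff_snd.comp contMDiff_phi_symm)
  refine ⟨hsm, Topology.IsEmbedding.subtypeVal, fun F => ?_⟩
  exact mfderiv_injective_of_leftInverse ((hr _).mdifferentiableAt (by simp))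
    ((hsm F).mdifferentiableAt (by simp)) phi₀Homeo.apply_symm_apply

theorem lieGroup_regMobius₀ : LieGroup (𝓡 3) ∞ RegMobius₀ where
  contMDiff_mul := by
    -- The factors are swapped because R_u ∘ R_v = R_{vu}: `phi₀Homeo` reverses products.
    have h : ContMDiff ((𝓡 3).prod (𝓡 3)) (𝓡 3) ∞ fun p : RegMobius₀ × RegMobius₀ =>
        phi₀Homeo (phi₀Homeo.symm p.2 * phi₀Homeo.symm p.1) :=
      contMDiff_phi₀.comp (contMDiff_sp1_mul (contMDiff_phi₀_symm.comp contMDiff_snd)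
        (contMDiff_phi₀_symm.comp contMDiff_fst))
    refine h.congr fun p => ?_
    rw [← phi₀_mul, Homeomorph.apply_symm_apply, Homeomorph.apply_symm_apply]
  contMDiff_inv := contMDiff_phi₀.comp (contMDiff_sp1_inv contMDiff_phi₀_symm)

/-! ### The action as right translation on Sp(1) -/

theorem smul_eq_phi (F₀ : RegMobius₀) (F : RegMobius) : F₀ • F =
    phiHomeo ((phiHomeo.symm F).1, (phiHomeo.symm F).2 * phi₀Homeo.symm F₀) := by
  have h0 : F₀.1 = phi (0, phi₀Homeo.symm F₀) :=
    (congrArg Subtype.val (phi₀Homeo.apply_symm_apply F₀)).symm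
  refine RegMobius.ext_fun ?_
  change F₀.1.toFun ∘ F.toFun = _
  conv_lhs => rw [h0, ← phi.apply_symm_apply F, phi_comp]
  rfl

theorem contMDiff_smul_regMobius : ContMDiff ((𝓡 3).prod modelRegMobius) modelRegMobius ∞
    (fun p : RegMobius₀ × RegMobius => p.1 • p.2) := by
  have h : ContMDiff ((𝓡 3).prod modelRegMobius) modelRegMobius ∞
      fun p : RegMobius₀ × RegMobius =>
        phiHomeo ((phiHomeo.symm p.2).1, (phiHomeo.symm p.2).2 * phi₀Homeo.symm p.1) :=
    contMDiff_phi.comp ((contMDiff_fst.comp (contMDiff_phi_symm.comp contMDiff_snd)).prodMk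
      (contMDiff_sp1_mul (contMDiff_snd.comp (contMDiff_phi_symm.comp contMDiff_snd))
        (contMDiff_phi₀_symm.comp contMDiff_fst)))
  exact h.congr fun p => smul_eq_phi p.1 p.2

/-- If R_v fixes the map with coordinates (a, u), the second coordinates give u v = u, hence v = 1.
-/
theorem isFreeAction_regMobius : IsFreeAction RegMobius₀ RegMobius := by
  intro F₀ F h
  rw [smul_eq_phi, ← phiHomeo.eq_symm_apply] at h
  have hu : phi₀Homeo.symm F₀ = 1 := mul_eq_left.1 (congrArg Prod.snd h)
  rw [← phi₀Homeo.apply_symm_apply F₀, hu, phi₀_one]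

/-- The set in question is the projection to `G` of the pairs (g, x) with x and g x in `K`. These
pairs form a closed subset of the compact set `G × K`, since `K` is closed in the Hausdorff space
`X` and the action is continuous. -/
theorem isProperAction_of_compactSpace (G X : Type*) [TopologicalSpace G] [TopologicalSpace X]
    [CompactSpace G] [T2Space X] [SMul G X] [ContinuousSMul G X] : IsProperAction G X := by
  intro K hK
  have hc : IsCompact {p : G × X | p.2 ∈ K ∧ p.1 • p.2 ∈ K} := by
    refine (isCompact_univ.prod hK).of_isClosed_subset ?_ fun p hp => ⟨trivial, hp.1⟩
    exact (hK.isClosed.preimage continuous_snd).inter (hK.isClosed.preimage continuous_smul)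
  convert hc.image continuous_fst using 1
  ext g
  constructor
  · rintro ⟨_, ⟨x, hx, rfl⟩, hgx⟩
    exact ⟨(g, x), ⟨hx, hgx⟩, rfl⟩
  · rintro ⟨⟨_, x⟩, ⟨hx, hgx⟩, rfl⟩
    exact ⟨_, ⟨x, hx, rfl⟩, hgx⟩

theorem isProperAction_regMobius : IsProperAction RegMobius₀ RegMobius := by
  -- 𝓜(𝔹)₀ is homeomorphic to the sphere Sp(1).
  have : CompactSpace RegMobius₀ := phi₀Homeo.compactSpace
  have : ContinuousSMul RegMobius₀ RegMobius := ⟨contMDiff_smul_regMobius.continuous⟩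
  exact isProperAction_of_compactSpace _ _

end SliceMobius

end

theorem mainTheorem8 :
    IsEmbeddedSubmanifoldMap modelSp11 𝓘(ℝ, Fin 2 → Fin 2 → ℍ[ℝ])
        (fun (A : Sp11) (i j : Fin 2) => A.1 i j) ∧
    IsSmoothSubmersion modelSp11 modelRegMobius toRegMobius ∧
    IsEmbeddedSubmanifoldMap (𝓡 3) modelRegMobius (Subtype.val : RegMobius₀ → RegMobius) ∧
    LieGroup (𝓡 3) ∞ RegMobius₀ ∧
    (∀ F₀ G₀ : RegMobius₀, (F₀ * G₀).1.toFun = F₀.1.toFun ∘ G₀.1.toFun) ∧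
    (∀ (F₀ : RegMobius₀) (F : RegMobius), (F₀ • F).toFun = F₀.1.toFun ∘ F.toFun) ∧
    ContMDiff ((𝓡 3).prod modelRegMobius) modelRegMobius ∞
      (fun p : RegMobius₀ × RegMobius => p.1 • p.2) ∧
    IsFreeAction RegMobius₀ RegMobius ∧
    IsProperAction RegMobius₀ RegMobius := by
  exact ⟨isEmbeddedSubmanifoldMap_sp11, isSmoothSubmersion_toRegMobius,
    isEmbeddedSubmanifoldMap_regMobius₀, lieGroup_regMobius₀, fun _ _ => rfl, fun _ _ => rfl,
    contMDiff_smul_regMobius, isFreeAction_regMobius, isProperAction_regMobius⟩
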